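/- Let $k$ be a field, let $H$ be a Hopf algebra over $k$ with comultiplication $\Delta$, counit $\varepsilon$ and bijective antipode, and let $P$ be a unital $k$-algebra that is a right $H$-comodule algebra: it carries a coassociative and counital coaction $\Delta_R: P\to P\otimes H$, $p\mapsto p_{(0)}\otimes p_{(1)}$, which is a homomorphism of algebras (unadorned tensor products are over $k$). Let $B=\{b\in P : \Delta_R(b)=b\otimes 1\}$ and assume that $B\subseteq P$ is an $H$-Galois extension, i.e. that the canonical map $$\chi: P\otimes_B P\to P\otimes H,\qquad p\otimes_B p'\mapsto p\,p'_{(0)}\otimes p'_{(1)},$$ is bijective. For an algebra $A$ write $\Omega^1A=\ker(A\otimes A\to A)$ for the kernel of the multiplication map and $\mathrm{d}a=1\otimes a-a\otimes 1$. Let $(\Omega^1B)P\subseteq P\otimes P$ be the $k$-span of all $\omega p$ and $P(\Omega^1B)P$ the $k$-span of all $p'\omega p$, with $\omega\in\Omega^1B$ and $p,p'\in P$. Assume that $B\subseteq P$ admits a strong connection, i.e. a left $P$-linear map $\Pi:\Omega^1P\to\Omega^1P$ such that $\Pi^2=\Pi$, $\ker\Pi=P(\Omega^1B)P$, $\Pi$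 is right $H$-colinear for the restriction to $\Omega^1P$ of the diagonal coaction $p\otimes p'\mapsto p_{(0)}\otimes p'_{(0)}\otimes p_{(1)}p'_{(1)}$ of $P\otimes P$, and $(\mathrm{id}-\Pi)(\mathrm{d}P)\subseteq(\Omega^1B)P$. Let $V$ be a finite-dimensional $k$-vector space and $\rho:V\to V\otimes H$ a corepresentation of $H$ (a coassociative and counital linear map). Then the space of colinear maps $$\mathrm{Hom}_\rho(V,P)=\{\varphi\in\mathrm{Hom}_k(V,P) : \Delta_R\circ\varphi=(\varphi\otimes\mathrm{id})\circ\rho\},$$ with the left $B$-module structure $(b\varphi)(v)=b\,\varphi(v)$, is finitely generated and projective as a left $B$-module. -/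

import Mathlib

open scoped TensorProduct

namespace HopfGalois

section Comodules

variable {k H V W : Type*} [Field k] [Ring H] [HopfAlgebra k H]
  [AddCommGroup V] [Module k V] [AddCommGroup W] [Module k W]

/-- A right coaction (corepresentation) `ρ : V → V ⊗ H`: coassociative and counital. -/
structure IsCorepresentation (ρ : V →ₗ[k] V ⊗[k] H) : Prop where
  coassoc : (TensorProduct.assoc k V H H).toLinearMap ∘ₗ ρ.rTensor H ∘ₗ ρ =
    (Coalgebra.comul (R := k) (A := H)).lTensor V ∘ₗ ρ
  counit : (TensorProduct.rid k V).toLinearMap ∘ₗ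
    (Coalgebra.counit (R := k) (A := H)).lTensor V ∘ₗ ρ = LinearMap.id

/-- A linear map `f : V → W` is colinear: `δ ∘ f = (f ⊗ id) ∘ ρ`. -/
def IsColinear (ρ : V →ₗ[k] V ⊗[k] H) (δ : W →ₗ[k] W ⊗[k] H) (f : V →ₗ[k] W) : Prop :=
  δ ∘ₗ f = f.rTensor H ∘ₗ ρ

end Comodules

section UniversalCalculus

variable (k A : Type*) [Field k] [Ring A] [Algebra k A]

/-- The multiplication map `A ⊗ A → A`, as a map of left `A`-modules. -/
noncomputable def mulMap : A ⊗[k] A →ₗ[A] A :=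
  { LinearMap.mul' k A with
    map_smul' := by
      intro a x
      induction x using TensorProduct.induction_on with
      | zero => simp
      | tmul x y => simp [TensorProduct.smul_tmul', mul_assoc]
      | add x y hx hy =>
        simp only [AddHom.toFun_eq_coe, LinearMap.coe_toAddHom, RingHom.id_apply] at hx hy ⊢
        rw [smul_add, map_add, hx, hy, map_add, smul_add] }

@[simp]
theorem mulMap_tmul (a b : A) : mulMap k A (a ⊗ₜ[k] b) = a * b := by
  simp [mulMap]

/-- The universal differential calculus `Ω¹A`: the kernel of the multiplication map,
a left `A`-submodule of `A ⊗ A`. -/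
noncomputable def universalForms : Submodule A (A ⊗[k] A) :=
  LinearMap.ker (mulMap k A)

/-- The universal differential `d a = 1 ⊗ a - a ⊗ 1`. -/
noncomputable def universalD (a : A) : universalForms k A :=
  ⟨(1 : A) ⊗ₜ[k] a - a ⊗ₜ[k] (1 : A), by simp [universalForms]⟩

/-- The inclusion `Ω¹A → A ⊗ A`, as a `k`-linear map. -/
noncomputable def formsIncl : universalForms k A →ₗ[k] A ⊗[k] A :=
  (universalForms k A).subtype.restrictScalars k

/-- The `k`-linear retraction `x ↦ x - m(x) ⊗ 1` of `A ⊗ A` onto `Ω¹A`. -/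
noncomputable def formsRetract : A ⊗[k] A →ₗ[k] universalForms k A where
  toFun x := ⟨x - mulMap k A x ⊗ₜ[k] (1 : A), by simp [universalForms]⟩
  map_add' x y := by
    ext
    simp only [map_add, TensorProduct.add_tmul, Submodule.coe_add]
    abel
  map_smul' c x := by
    ext
    simp [smul_sub, TensorProduct.smul_tmul']

end UniversalCalculus

section Extension

variable {k H P : Type*} [Field k] [Ring H] [HopfAlgebra k H] [Ring P] [Algebra k P]

/-- The subalgebra `B = P^{co H}` of coinvariants `{b | δ b = b ⊗ 1}`. -/
noncomputable def coinvariants (δ : P →ₐ[k] P ⊗[k] H) : Subalgebra k P :=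
  AlgHom.equalizer δ Algebra.TensorProduct.includeLeft

theorem mem_coinvariants {δ : P →ₐ[k] P ⊗[k] H} {b : P} :
    b ∈ coinvariants δ ↔ δ b = b ⊗ₜ[k] (1 : H) :=
  Iff.rfl

/-- The `k`-subspace of `P ⊗ P` spanned by `p b ⊗ p' - p ⊗ b p'` for `b ∈ B`. -/
noncomputable def balancingRelations (B : Subalgebra k P) : Submodule k (P ⊗[k] P) :=
  Submodule.span k
    {x | ∃ (p : P) (b : B) (p' : P), x = (p * b) ⊗ₜ[k] p' - p ⊗ₜ[k] ((b : P) * p')}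

/-- The tensor product `P ⊗_B P` over the (possibly noncommutative) subalgebra `B`. -/
abbrev BalancedTensor (B : Subalgebra k P) : Type _ :=
  (P ⊗[k] P) ⧸ balancingRelations B

/-- The map `P ⊗ P → P ⊗ H`, `p ⊗ p' ↦ p p'₍₀₎ ⊗ p'₍₁₎`. -/
noncomputable def preCanonicalMap (δ : P →ₐ[k] P ⊗[k] H) : P ⊗[k] P →ₗ[k] P ⊗[k] H :=
  (LinearMap.mul' k P).rTensor H ∘ₗ (TensorProduct.assoc k P P H).symm.toLinearMap ∘ₗ
    δ.toLinearMap.lTensor P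

theorem preCanonicalMap_tmul (δ : P →ₐ[k] P ⊗[k] H) (p p' : P) :
    preCanonicalMap δ (p ⊗ₜ[k] p') = (p ⊗ₜ[k] (1 : H)) * δ p' := by
  simp only [preCanonicalMap, LinearMap.comp_apply, LinearMap.lTensor_tmul,
    AlgHom.toLinearMap_apply]
  induction δ p' using TensorProduct.induction_on with
  | zero => simp
  | tmul x y => simp
  | add x y hx hy => rw [TensorProduct.tmul_add, map_add, map_add, hx, hy, mul_add]

theorem balancingRelations_le_ker (δ : P →ₐ[k] P ⊗[k] H) :
    balancingRelations (coinvariants δ) ≤ LinearMap.ker (preCanonicalMap δ) := by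
  refine Submodule.span_le.2 ?_
  rintro x ⟨p, b, p', rfl⟩
  have hb : δ (b : P) = (b : P) ⊗ₜ[k] (1 : H) := b.2
  simp [preCanonicalMap_tmul, hb, ← mul_assoc]

/-- The canonical map `χ : P ⊗_B P → P ⊗ H`, `p ⊗_B p' ↦ p p'₍₀₎ ⊗ p'₍₁₎`, where `B` is the
subalgebra of coinvariants. -/
noncomputable def canonicalMap (δ : P →ₐ[k] P ⊗[k] H) :
    BalancedTensor (coinvariants δ) →ₗ[k] P ⊗[k] H :=
  (balancingRelations (coinvariants δ)).liftQ (preCanonicalMap δ) (balancingRelations_le_ker δ)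

/-- `P`, with the coaction `δ`, is a right `H`-comodule algebra and `B = P^{co H} ⊆ P` is an
`H`-Galois extension: the canonical map is bijective. (That `δ` is an algebra map is part of its
type.) -/
structure IsHopfGaloisExtension (δ : P →ₐ[k] P ⊗[k] H) : Prop where
  isCorepresentation : IsCorepresentation δ.toLinearMap
  bijective_canonicalMap : Function.Bijective (canonicalMap δ)

/-- The diagonal coaction `p ⊗ p' ↦ p₍₀₎ ⊗ p'₍₀₎ ⊗ p₍₁₎ p'₍₁₎` on `P ⊗ P`. -/
noncomputable def diagonalCoaction (δ : P →ₐ[k] P ⊗[k] H) :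
    P ⊗[k] P →ₗ[k] (P ⊗[k] P) ⊗[k] H :=
  (LinearMap.mul' k H).lTensor (P ⊗[k] P) ∘ₗ
    (TensorProduct.tensorTensorTensorComm k P H P H).toLinearMap ∘ₗ
    TensorProduct.map δ.toLinearMap δ.toLinearMap

/-- The diagonal coaction restricted to `Ω¹P`. The restriction takes values in `Ω¹P ⊗ H`
(see `formsIncl_formsCoaction`); the retraction only serves to corestrict it. -/
noncomputable def formsCoaction (δ : P →ₐ[k] P ⊗[k] H) :
    universalForms k P →ₗ[k] universalForms k P ⊗[k] H :=
  (formsRetract k P).rTensor H ∘ₗ diagonalCoaction δ ∘ₗ formsIncl k P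

theorem mul_diagonalCoaction (δ : P →ₐ[k] P ⊗[k] H) (x : P ⊗[k] P) :
    (LinearMap.mul' k P).rTensor H (diagonalCoaction δ x) = δ (LinearMap.mul' k P x) := by
  induction x using TensorProduct.induction_on with
  | zero => simp
  | add x y hx hy => simp only [map_add, hx, hy]
  | tmul p q =>
    simp only [diagonalCoaction, LinearMap.comp_apply, TensorProduct.map_tmul,
      AlgHom.toLinearMap_apply, LinearMap.mul'_apply, map_mul]
    induction δ p using TensorProduct.induction_on with
    | zero => simp
    | add x y hx hy => simp only [TensorProduct.add_tmul, map_add, hx, hy, add_mul]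
    | tmul a h =>
      induction δ q using TensorProduct.induction_on with
      | zero => simp
      | add x y hx hy => simp only [TensorProduct.tmul_add, map_add, hx, hy, mul_add]
      | tmul b g => simp

/-- `formsCoaction` is the restriction of the diagonal coaction to `Ω¹P`. -/
theorem formsIncl_formsCoaction (δ : P →ₐ[k] P ⊗[k] H) (w : universalForms k P) :
    (formsIncl k P).rTensor H (formsCoaction δ w) = diagonalCoaction δ (w : P ⊗[k] P) := by
  have key : ∀ y : (P ⊗[k] P) ⊗[k] H,
      (formsIncl k P).rTensor H ((formsRetract k P).rTensor H y) =
        y - ((TensorProduct.mk k P P).flip 1).rTensor H ((LinearMap.mul' k P).rTensor H y) := by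
    intro y
    induction y using TensorProduct.induction_on with
    | zero => simp
    | add x y hx hy => simp only [map_add, hx, hy]; abel
    | tmul x h =>
      simp [formsIncl, formsRetract, mulMap, TensorProduct.sub_tmul]
  have hw : LinearMap.mul' k P (w : P ⊗[k] P) = 0 := w.2
  rw [formsCoaction, LinearMap.comp_apply, LinearMap.comp_apply, key]
  change diagonalCoaction δ (w : P ⊗[k] P) - _ = _
  rw [show formsIncl k P w = (w : P ⊗[k] P) from rfl, mul_diagonalCoaction, hw]
  simp

/-- The `k`-subspace `(Ω¹B)P` of `P ⊗ P`: sums of elements `∑ᵢ bᵢ ⊗ b'ᵢ p` with `p ∈ P` and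
`∑ᵢ bᵢ ⊗ b'ᵢ ∈ Ω¹B`. -/
noncomputable def formsMul (B : Subalgebra k P) : Submodule k (P ⊗[k] P) :=
  Submodule.span k
    {x | ∃ w ∈ universalForms k B, ∃ p : P,
      x = (LinearMap.mulRight k p).lTensor P
        (TensorProduct.map B.val.toLinearMap B.val.toLinearMap w)}

/-- The horizontal forms `P(Ω¹B)P`: the left `P`-submodule generated by `(Ω¹B)P`. -/
noncomputable def horizontalForms (B : Subalgebra k P) : Submodule P (P ⊗[k] P) :=
  Submodule.span P (formsMul B : Set (P ⊗[k] P))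

/-- A connection: a left `P`-linear right `H`-colinear idempotent endomorphism of `Ω¹P` whose
kernel is the space `P(Ω¹B)P` of horizontal forms. -/
structure IsConnection (δ : P →ₐ[k] P ⊗[k] H)
    (pr : universalForms k P →ₗ[P] universalForms k P) : Prop where
  idempotent : pr ∘ₗ pr = pr
  ker_eq : (LinearMap.ker pr).map (universalForms k P).subtype = horizontalForms (coinvariants δ)
  colinear : IsColinear (formsCoaction δ) (formsCoaction δ) (pr.restrictScalars k)

/-- A strong connection: a connection with `(id - pr)(dP) ⊆ (Ω¹B)P`. -/
structure IsStrongConnection (δ : P →ₐ[k] P ⊗[k] H)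
    (pr : universalForms k P →ₗ[P] universalForms k P) : Prop extends IsConnection δ pr where
  strong : ∀ p : P, ((universalD k P p - pr (universalD k P p) : universalForms k P) : P ⊗[k] P) ∈
    formsMul (coinvariants δ)

variable {V : Type*} [AddCommGroup V] [Module k V]

/-- The left `B`-module `Hom_ρ(V, P)` of colinear maps `V → P`, with `(b • φ) v = b * φ v`. -/
noncomputable def colinearHom (ρ : V →ₗ[k] V ⊗[k] H) (δ : P →ₐ[k] P ⊗[k] H) :
    Submodule (coinvariants δ) (V →ₗ[k] P) where
  carrier := {φ | IsColinear ρ δ.toLinearMap φ}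
  zero_mem' := by simp [IsColinear]
  add_mem' := by
    intro f g hf hg
    change _ = _ at hf hg ⊢
    rw [LinearMap.comp_add, hf, hg, LinearMap.rTensor_add, LinearMap.add_comp]
  smul_mem' := by
    intro b f hf
    change _ = _ at hf ⊢
    have hb : δ (b : P) = (b : P) ⊗ₜ[k] (1 : H) := b.2
    ext v
    have hv : δ (f v) = f.rTensor H (ρ v) := LinearMap.congr_fun hf v
    have h1 : δ ((b • f) v) = ((b : P) ⊗ₜ[k] (1 : H)) * δ (f v) := by
      rw [← hb, ← map_mul]; rfl
    simp only [LinearMap.comp_apply, AlgHom.toLinearMap_apply]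
    rw [h1, hv]
    induction ρ v using TensorProduct.induction_on with
    | zero => simp
    | add x y hx hy => simp only [map_add, mul_add, hx, hy]
    | tmul x h =>
      simp only [LinearMap.rTensor_tmul, Algebra.TensorProduct.tmul_mul_tmul, one_mul]
      rfl

end Extension

end HopfGalois

/-! Let `d` be the universal differential and `pr` a strong connection. The map
`s p = p ⊗ 1 + pr (d p)` is a left `B`-linear, `H`-colinear section of the multiplication
`B ⊗ P → P`. Since `V` is finite-dimensional, `φ ↦ s ∘ φ` is a section of the multiplication
`B ⊗ Hom(V, P) → Hom(V, P)`, and it maps `Hom_ρ(V, P)` into `B ⊗ Hom_ρ(V, P)`. The Galois condition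
cuts the second factor down to a finite-dimensional one: writing `χ⁻¹(1 ⊗ h) = h⁽¹⁾ ⊗ h⁽²⁾`, one has
`s (φ v) = φ(v₍₀₎) v₍₁₎⁽¹⁾ s(v₍₁₎⁽²⁾)`, so the right legs of the tensors `s (φ v)` all lie in one
finite-dimensional `W ⊆ P` that does not depend on `φ`. Hence `Hom_ρ(V, P)` is a direct summand of
`B ⊗ Hom_ρ(V, W)`. -/

namespace HopfGalois

section TensorProduct

variable {k : Type*} [Field k]

section Slices

variable {M N N' : Type*} [AddCommGroup M] [Module k M] [AddCommGroup N] [Module k N]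
  [AddCommGroup N'] [Module k N']

/-- The slice map `m ⊗ n ↦ f(m) n` of a linear functional `f` on the left leg. -/
noncomputable def slice (f : M →ₗ[k] k) : M ⊗[k] N →ₗ[k] N :=
  (TensorProduct.lid k N).toLinearMap ∘ₗ f.rTensor N

@[simp]
theorem slice_tmul (f : M →ₗ[k] k) (m : M) (n : N) : slice f (m ⊗ₜ[k] n) = f m • n := by
  simp [slice]

theorem slice_comp_lTensor (f : M →ₗ[k] k) (r : N →ₗ[k] N') :
    slice f ∘ₗ r.lTensor M = r ∘ₗ slice f :=
  TensorProduct.ext' fun m n => by simp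

theorem slice_comp_rTensor {M' : Type*} [AddCommGroup M'] [Module k M'] (f : M' →ₗ[k] k)
    (g : M →ₗ[k] M') : slice f ∘ₗ g.rTensor N = slice (f ∘ₗ g) :=
  TensorProduct.ext' fun m n => by simp

theorem tensor_ext_of_slice {x y : M ⊗[k] N} (h : ∀ f : M →ₗ[k] k, slice f x = slice f y) :
    x = y := by
  classical
  let b := Module.Basis.ofVectorSpace k M
  refine (TensorProduct.equivFinsuppOfBasisLeft b).injective (Finsupp.ext fun i => ?_)
  simpa only [TensorProduct.equivFinsuppOfBasisLeft_apply, slice, LinearMap.comp_apply,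
    LinearEquiv.coe_coe] using h (b.coord i)

theorem lTensor_eq_self_of_slice_mem {K : Submodule k N} {r : N →ₗ[k] K}
    (hr : r ∘ₗ K.subtype = LinearMap.id) {x : M ⊗[k] N}
    (hx : ∀ f : M →ₗ[k] k, slice f x ∈ K) : (K.subtype ∘ₗ r).lTensor M x = x :=
  tensor_ext_of_slice fun f => by
    rw [← LinearMap.comp_apply, slice_comp_lTensor]
    exact congrArg Subtype.val (LinearMap.congr_fun hr ⟨slice f x, hx f⟩)

theorem exists_finiteDimensional_forall_slice_mem {V : Type*} [AddCommGroup V] [Module k V]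
    [FiniteDimensional k V] (t : V →ₗ[k] M ⊗[k] N) :
    ∃ W : Submodule k N, FiniteDimensional k W ∧ ∀ (f : M →ₗ[k] k) (v : V), slice f (t v) ∈ W := by
  let e := Module.finBasis k V
  obtain ⟨W, hW, ht⟩ := TensorProduct.exists_finite_submodule_right_of_setFinite
    (Set.range (t ∘ e)) (Set.finite_range _)
  refine ⟨W, hW, fun f v => ?_⟩
  have hv : t v ∈ LinearMap.range (W.subtype.lTensor M) := by
    have hle : ⊤ ≤ (LinearMap.range (W.subtype.lTensor M)).comap t := by
      rw [← e.span_eq, Submodule.span_le]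
      rintro _ ⟨j, rfl⟩
      exact ht ⟨j, rfl⟩
    exact hle Submodule.mem_top
  obtain ⟨y, hy⟩ := hv
  rw [← hy, ← LinearMap.comp_apply, slice_comp_lTensor]
  exact (slice f y).2

end Slices

variable {A : Type*} [Ring A] [Algebra k A]

section LeftExtend

variable {M E : Type*} [AddCommGroup M] [Module k M] [AddCommGroup E] [Module k E] [Module A E]
  [IsScalarTower k A E]

variable (A) in
/-- The left `A`-linear extension `a ⊗ m ↦ a • l m` of a `k`-linear map `l`; unlike
`LinearMap.liftBaseChange`, it does not ask `A` to be commutative. -/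
noncomputable def leftExtend (l : M →ₗ[k] E) : A ⊗[k] M →ₗ[A] E :=
  TensorProduct.AlgebraTensorModule.lift (LinearMap.toSpanSingleton A (M →ₗ[k] E) l)

@[simp]
theorem leftExtend_tmul (l : M →ₗ[k] E) (a : A) (m : M) :
    leftExtend A l (a ⊗ₜ[k] m) = a • l m := by
  simp [leftExtend]

theorem leftExtend_id_lTensor (l : M →ₗ[k] E) (x : A ⊗[k] M) :
    leftExtend A LinearMap.id (l.lTensor A x) = leftExtend A l x := by
  induction x using TensorProduct.induction_on with
  | zero => simp
  | add x y hx hy => simp only [map_add, hx, hy]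
  | tmul a m => simp

/-- The section `T` takes values in `A ⊗ K`, hence exhibits `N` as a direct summand of this free
module of finite rank. -/
theorem finite_projective_of_slice_mem {N : Submodule A E} {K : Submodule k E}
    [FiniteDimensional k K] (hKN : K ≤ N.restrictScalars k) (T : N →ₗ[A] A ⊗[k] E)
    (hT : ∀ n, leftExtend A LinearMap.id (T n) = n) (hK : ∀ n f, slice f (T n) ∈ K) :
    Module.Finite A N ∧ Module.Projective A N := by
  obtain ⟨r, hr⟩ := K.subtype.exists_leftInverse_of_injective K.ker_subtype
  let i : N →ₗ[A] A ⊗[k] K := TensorProduct.AlgebraTensorModule.lTensor A A r ∘ₗ T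
  have hmem (y : A ⊗[k] K) : leftExtend A K.subtype y ∈ N := by
    induction y using TensorProduct.induction_on with
    | zero => simp
    | add x y hx hy => rw [map_add]; exact N.add_mem hx hy
    | tmul a m => rw [leftExtend_tmul]; exact N.smul_mem a (hKN m.2)
  let p : A ⊗[k] K →ₗ[A] N := (leftExtend A K.subtype).codRestrict N hmem
  have hpi : p ∘ₗ i = LinearMap.id := by
    ext n
    calc (p (i n) : E)
        = leftExtend A LinearMap.id ((K.subtype ∘ₗ r).lTensor A (T n)) := by
          rw [LinearMap.lTensor_comp_apply, leftExtend_id_lTensor]; rfl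
      _ = n := by rw [lTensor_eq_self_of_slice_mem hr (hK n), hT]
  exact ⟨.of_surjective p fun n => ⟨i n, LinearMap.congr_fun hpi n⟩, .of_split i p hpi⟩

end LeftExtend

section HomEquiv

variable {V E : Type*} [AddCommGroup V] [Module k V] [FiniteDimensional k V] [AddCommGroup E]
  [Module k E]

variable (k A V E) in
/-- The identification of `A ⊗ Hom(V, E)` with `Hom(V, A ⊗ E)` for finite-dimensional `V`, as left
`A`-modules. -/
noncomputable def tensorHomEquiv : A ⊗[k] (V →ₗ[k] E) ≃ₗ[A] (V →ₗ[k] A ⊗[k] E) :=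
  { lTensorHomEquivHomLTensor k V A E with
    map_smul' := fun a x => by
      induction x using TensorProduct.induction_on with
      | zero => simp
      | add x y hx hy => simp_all
      | tmul b φ => ext; simp [TensorProduct.smul_tmul'] }

@[simp]
theorem tensorHomEquiv_tmul (a : A) (φ : V →ₗ[k] E) (v : V) :
    tensorHomEquiv k A V E (a ⊗ₜ[k] φ) v = a ⊗ₜ[k] φ v := by
  simp [tensorHomEquiv]

theorem slice_tensorHomEquiv (f : A →ₗ[k] k) (x : A ⊗[k] (V →ₗ[k] E)) :
    slice f ∘ₗ tensorHomEquiv k A V E x = slice f x := by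
  induction x using TensorProduct.induction_on with
  | zero => simp
  | add x y hx hy => simp only [map_add, LinearMap.comp_add, hx, hy]
  | tmul a φ => ext; simp

theorem leftExtend_tensorHomEquiv [Module A E] [IsScalarTower k A E] (x : A ⊗[k] (V →ₗ[k] E))
    (v : V) : leftExtend A LinearMap.id (tensorHomEquiv k A V E x v) =
      leftExtend A (LinearMap.id : (V →ₗ[k] E) →ₗ[k] V →ₗ[k] E) x v := by
  induction x using TensorProduct.induction_on with
  | zero => simp
  | add x y hx hy => simp only [map_add, LinearMap.add_apply, hx, hy]
  | tmul a φ => simp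

end HomEquiv

end TensorProduct

section Comodules

variable {k H U V W : Type*} [Field k] [Ring H] [HopfAlgebra k H] [AddCommGroup U] [Module k U]
  [AddCommGroup V] [Module k V] [AddCommGroup W] [Module k W]
  {α : U →ₗ[k] U ⊗[k] H} {β : V →ₗ[k] V ⊗[k] H} {γ : W →ₗ[k] W ⊗[k] H}

namespace IsColinear

theorem comp {g : V →ₗ[k] W} {f : U →ₗ[k] V} (hg : IsColinear β γ g) (hf : IsColinear α β f) :
    IsColinear α γ (g ∘ₗ f) := by
  unfold IsColinear at *
  rw [← LinearMap.comp_assoc, hg, LinearMap.comp_assoc, hf, LinearMap.rTensor_comp,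
    LinearMap.comp_assoc]

theorem add {f g : U →ₗ[k] V} (hf : IsColinear α β f) (hg : IsColinear α β g) :
    IsColinear α β (f + g) := by
  unfold IsColinear at *
  rw [LinearMap.comp_add, hf, hg, LinearMap.rTensor_add, LinearMap.add_comp]

theorem sub {f g : U →ₗ[k] V} (hf : IsColinear α β f) (hg : IsColinear α β g) :
    IsColinear α β (f - g) := by
  unfold IsColinear at *
  rw [LinearMap.comp_sub, hf, hg, LinearMap.rTensor_sub, LinearMap.sub_comp]

theorem of_comp_injective {g : V →ₗ[k] W} {f : U →ₗ[k] V} (hinj : Function.Injective g)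
    (hg : IsColinear β γ g) (hgf : IsColinear α γ (g ∘ₗ f)) : IsColinear α β f := by
  unfold IsColinear at *
  rw [← LinearMap.cancel_left (Module.Flat.rTensor_preserves_injective_linearMap (M := H) g hinj),
    ← LinearMap.comp_assoc, ← hg, LinearMap.comp_assoc, hgf, LinearMap.rTensor_comp,
    LinearMap.comp_assoc]

end IsColinear

variable (U) in
/-- The coaction `id ⊗ γ` of `H` on the right leg of `U ⊗ W`. -/
noncomputable def rightLegCoaction (γ : W →ₗ[k] W ⊗[k] H) : U ⊗[k] W →ₗ[k] (U ⊗[k] W) ⊗[k] H :=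
  (TensorProduct.assoc k U W H).symm.toLinearMap ∘ₗ γ.lTensor U

theorem rightLegCoaction_tmul (γ : W →ₗ[k] W ⊗[k] H) (u : U) (w : W) :
    rightLegCoaction U γ (u ⊗ₜ[k] w) = (TensorProduct.mk k U W u).rTensor H (γ w) := by
  simp only [rightLegCoaction, LinearMap.comp_apply, LinearMap.lTensor_tmul, LinearEquiv.coe_coe]
  induction γ w using TensorProduct.induction_on with
  | zero => simp
  | add x y hx hy => simp only [TensorProduct.tmul_add, map_add, hx, hy]
  | tmul w h => simp

theorem isColinear_slice (γ : W →ₗ[k] W ⊗[k] H) (f : U →ₗ[k] k) :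
    IsColinear (rightLegCoaction U γ) γ (slice f) := by
  refine TensorProduct.ext' fun u w => ?_
  have hf : slice f ∘ₗ TensorProduct.mk k U W u = f u • LinearMap.id :=
    LinearMap.ext fun w => slice_tmul f u w
  rw [LinearMap.comp_apply, LinearMap.comp_apply, rightLegCoaction_tmul,
    ← LinearMap.rTensor_comp_apply, hf, LinearMap.rTensor_smul, LinearMap.rTensor_id, slice_tmul,
    map_smul]
  rfl

end Comodules

section Extension

variable {k H P : Type*} [Field k] [Ring H] [HopfAlgebra k H] [Ring P] [Algebra k P]
  {δ : P →ₐ[k] P ⊗[k] H}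

section Inclusion

variable (B : Subalgebra k P)

/-- The inclusion `B ⊗ P → P ⊗ P`, as a map of left `B`-modules. -/
noncomputable def tensorIncl : B ⊗[k] P →ₗ[B] P ⊗[k] P :=
  leftExtend B (TensorProduct.mk k P P 1)

@[simp]
theorem tensorIncl_tmul (b : B) (p : P) : tensorIncl B (b ⊗ₜ[k] p) = (b : P) ⊗ₜ[k] p := by
  simp [tensorIncl, Subalgebra.smul_def, TensorProduct.smul_tmul']

theorem tensorIncl_eq_rTensor :
    (tensorIncl B).restrictScalars k = B.val.toLinearMap.rTensor P :=
  TensorProduct.ext' fun b p => by simp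

theorem tensorIncl_injective : Function.Injective (tensorIncl B) := by
  have h := Module.Flat.rTensor_preserves_injective_linearMap (M := P) B.val.toLinearMap
    Subtype.val_injective
  rwa [← tensorIncl_eq_rTensor] at h

variable {B}

theorem exists_slice_tensorIncl (f : B →ₗ[k] k) :
    ∃ f' : P →ₗ[k] k, ∀ x, slice f' (tensorIncl B x) = slice f x := by
  obtain ⟨f', hf'⟩ := LinearMap.exists_extend (p := B.toSubmodule) f
  refine ⟨f', fun x => ?_⟩
  have h := LinearMap.congr_fun (slice_comp_rTensor (N := P) f' B.val.toLinearMap) x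
  rw [← tensorIncl_eq_rTensor] at h
  exact h.trans (congrArg (slice · x) hf')

theorem formsMul_le_range_tensorIncl :
    formsMul B ≤ (LinearMap.range (tensorIncl B)).restrictScalars k := by
  refine Submodule.span_le.2 ?_
  rintro _ ⟨w, -, p, rfl⟩
  refine ⟨(LinearMap.mulRight k p ∘ₗ B.val.toLinearMap).lTensor B w, ?_⟩
  induction w using TensorProduct.induction_on with
  | zero => simp
  | add x y hx hy => simp only [map_add, hx, hy]
  | tmul b b' => simp

end Inclusion

section Galois

theorem preCanonicalMap_smul (p : P) (x : P ⊗[k] P) :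
    preCanonicalMap δ (p • x) = p • preCanonicalMap δ x := by
  induction x using TensorProduct.induction_on with
  | zero => simp
  | add x y hx hy => simp only [smul_add, map_add, hx, hy]
  | tmul q r =>
    rw [TensorProduct.smul_tmul', preCanonicalMap_tmul, preCanonicalMap_tmul,
      ← smul_mul_assoc, TensorProduct.smul_tmul']

variable {E : Type*} [AddCommGroup E] [Module k E] [Module P E] [IsScalarTower k P E]

theorem leftExtend_eq_of_preCanonicalMap_eq (hχ : Function.Injective (canonicalMap δ))
    (L : P →ₗ[coinvariants δ] E) {x y : P ⊗[k] P}
    (hxy : preCanonicalMap δ x = preCanonicalMap δ y) :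
    leftExtend P (L.restrictScalars k) x = leftExtend P (L.restrictScalars k) y := by
  have hker : balancingRelations (coinvariants δ) ≤
      (LinearMap.ker (leftExtend P (L.restrictScalars k))).restrictScalars k := by
    refine Submodule.span_le.2 ?_
    rintro _ ⟨p, b, q, rfl⟩
    have hL : L ((b : P) * q) = (b : P) • L q := L.map_smul b q
    simp [hL, mul_smul]
  have hmk : (balancingRelations (coinvariants δ)).mkQ x =
      (balancingRelations (coinvariants δ)).mkQ y := hχ hxy
  rw [← sub_eq_zero, ← map_sub]
  exact hker ((Submodule.Quotient.eq _).1 hmk)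

/-- Here `ℓ` is the translation map `h ↦ χ⁻¹(1 ⊗ h)` followed by `p ⊗ p' ↦ p L(p')`. -/
theorem exists_leftExtend_coaction_eq (hχ : Function.Bijective (canonicalMap δ))
    (L : P →ₗ[coinvariants δ] E) : ∃ ℓ : H →ₗ[k] E, ∀ p, leftExtend P ℓ (δ p) = L p := by
  have hsurj : Function.Surjective (preCanonicalMap δ) :=
    hχ.surjective.comp (Submodule.mkQ_surjective _)
  obtain ⟨g, hg⟩ := (preCanonicalMap δ).exists_rightInverse_of_surjective
    (LinearMap.range_eq_top.2 hsurj)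
  let τ : H →ₗ[k] P ⊗[k] P := g ∘ₗ TensorProduct.mk k P H 1
  have hτ (z : P ⊗[k] H) : preCanonicalMap δ (leftExtend P τ z) = z := by
    induction z using TensorProduct.induction_on with
    | zero => simp
    | add x y hx hy => simp only [map_add, hx, hy]
    | tmul p h =>
      have hh : preCanonicalMap δ (τ h) = 1 ⊗ₜ[k] h := LinearMap.congr_fun hg _
      rw [leftExtend_tmul, preCanonicalMap_smul, hh, TensorProduct.smul_tmul', smul_eq_mul,
        mul_one]
  let Λ := leftExtend P (L.restrictScalars k)
  have hΛ (z : P ⊗[k] H) : leftExtend P (Λ.restrictScalars k ∘ₗ τ) z = Λ (leftExtend P τ z) := by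
    induction z using TensorProduct.induction_on with
    | zero => simp
    | add x y hx hy => simp only [map_add, hx, hy]
    | tmul p h => simp
  refine ⟨Λ.restrictScalars k ∘ₗ τ, fun p => ?_⟩
  have hp : preCanonicalMap δ (leftExtend P τ (δ p)) = preCanonicalMap δ (1 ⊗ₜ[k] p) := by
    rw [hτ, preCanonicalMap_tmul, ← Algebra.TensorProduct.one_def, one_mul]
  rw [hΛ, leftExtend_eq_of_preCanonicalMap_eq hχ.injective L hp]
  simp

end Galois

section ColinearHom

variable {V : Type*} [AddCommGroup V] [Module k V]

/-- Both sides send `v ⊗ h` to `φ(v) ℓ(h)`; on the right, `φ` acts on the left leg only. -/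
theorem leftExtend_rTensor (φ : V →ₗ[k] P) (ℓ : H →ₗ[k] P ⊗[k] P) (z : V ⊗[k] H) :
    leftExtend P ℓ (φ.rTensor H z) = (LinearMap.mul' k P ∘ₗ φ.rTensor P).rTensor P
      ((TensorProduct.assoc k V P P).symm (ℓ.lTensor V z)) := by
  induction z using TensorProduct.induction_on with
  | zero => simp
  | add x y hx hy => simp only [map_add, hx, hy]
  | tmul v h =>
    simp only [LinearMap.rTensor_tmul, leftExtend_tmul, LinearMap.lTensor_tmul]
    induction ℓ h using TensorProduct.induction_on with
    | zero => simp
    | add x y hx hy => simp only [smul_add, TensorProduct.tmul_add, map_add, hx, hy]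
    | tmul p q => simp [TensorProduct.smul_tmul']

theorem exists_finiteDimensional_forall_colinear_slice_mem [FiniteDimensional k V]
    (hχ : Function.Bijective (canonicalMap δ))
    (s : P →ₗ[coinvariants δ] coinvariants δ ⊗[k] P) (ρ : V →ₗ[k] V ⊗[k] H) :
    ∃ W : Submodule k P, FiniteDimensional k W ∧ ∀ φ ∈ colinearHom ρ δ,
      ∀ (f : coinvariants δ →ₗ[k] k) (v : V), slice f (s (φ v)) ∈ W := by
  obtain ⟨ℓ, hℓ⟩ := exists_leftExtend_coaction_eq hχ (tensorIncl (coinvariants δ) ∘ₗ s)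
  obtain ⟨W, hW, hmem⟩ := exists_finiteDimensional_forall_slice_mem
    ((TensorProduct.assoc k V P P).symm.toLinearMap ∘ₗ ℓ.lTensor V ∘ₗ ρ)
  refine ⟨W, hW, fun φ hφ f v => ?_⟩
  obtain ⟨f', hf'⟩ := exists_slice_tensorIncl f
  have hφv : δ (φ v) = φ.rTensor H (ρ v) := LinearMap.congr_fun hφ v
  have hs : tensorIncl _ (s (φ v)) = (LinearMap.mul' k P ∘ₗ φ.rTensor P).rTensor P
      ((TensorProduct.assoc k V P P).symm (ℓ.lTensor V (ρ v))) := by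
    rw [← leftExtend_rTensor, ← hφv, hℓ, LinearMap.comp_apply]
  rw [← hf', hs, ← LinearMap.comp_apply, slice_comp_rTensor]
  exact hmem _ v

/-- A left `B`-linear right `H`-colinear splitting of the multiplication map `B ⊗ P → P`, where
`B` is the subalgebra of coinvariants and `H` coacts on `B ⊗ P` through `P`. Its existence is the
`H`-equivariant projectivity of the left `B`-module `P`. -/
structure IsEquivariantSplitting (δ : P →ₐ[k] P ⊗[k] H)
    (s : P →ₗ[coinvariants δ] coinvariants δ ⊗[k] P) : Prop where
  leftExtend_apply : ∀ p, leftExtend (coinvariants δ) LinearMap.id (s p) = p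
  colinear : IsColinear δ.toLinearMap (rightLegCoaction (coinvariants δ) δ.toLinearMap)
    (s.restrictScalars k)

/-- The map `φ ↦ s ∘ φ`, with `Hom(V, B ⊗ P)` read as `B ⊗ Hom(V, P)`. -/
noncomputable def splitHom [FiniteDimensional k V] {B : Subalgebra k P} (s : P →ₗ[B] B ⊗[k] P) :
    (V →ₗ[k] P) →ₗ[B] B ⊗[k] (V →ₗ[k] P) :=
  (tensorHomEquiv k B V P).symm.toLinearMap ∘ₗ
    { toFun := fun φ => s.restrictScalars k ∘ₗ φ
      map_add' := fun φ ψ => LinearMap.comp_add φ ψ (s.restrictScalars k)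
      map_smul' := fun b φ => LinearMap.ext fun v => s.map_smul b (φ v) }

theorem tensorHomEquiv_splitHom [FiniteDimensional k V] {B : Subalgebra k P}
    (s : P →ₗ[B] B ⊗[k] P) (φ : V →ₗ[k] P) :
    tensorHomEquiv k B V P (splitHom s φ) = s.restrictScalars k ∘ₗ φ :=
  LinearEquiv.apply_symm_apply _ _

end ColinearHom

section StrongConnection

theorem diagonalCoaction_tmul_of_mem {c : P} (hc : c ∈ coinvariants δ) (p : P) :
    diagonalCoaction δ (c ⊗ₜ[k] p) = (TensorProduct.mk k P P c).rTensor H (δ p) := by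
  simp only [diagonalCoaction, LinearMap.comp_apply, TensorProduct.map_tmul,
    AlgHom.toLinearMap_apply, mem_coinvariants.1 hc]
  induction δ p using TensorProduct.induction_on with
  | zero => simp
  | add x y hx hy => simp only [TensorProduct.tmul_add, map_add, hx, hy]
  | tmul q h => simp

theorem isColinear_tensorIncl :
    IsColinear (rightLegCoaction (coinvariants δ) δ.toLinearMap) (diagonalCoaction δ)
      ((tensorIncl (coinvariants δ)).restrictScalars k) := by
  refine TensorProduct.ext' fun b p => ?_
  have hb : (tensorIncl (coinvariants δ)).restrictScalars k ∘ₗ TensorProduct.mk k _ P b =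
      TensorProduct.mk k P P b :=
    LinearMap.ext fun p => tensorIncl_tmul _ b p
  rw [LinearMap.comp_apply, LinearMap.comp_apply, rightLegCoaction_tmul,
    ← LinearMap.rTensor_comp_apply, hb, LinearMap.restrictScalars_apply, tensorIncl_tmul,
    diagonalCoaction_tmul_of_mem b.2]
  rfl

theorem isColinear_mk_one :
    IsColinear δ.toLinearMap (diagonalCoaction δ) (TensorProduct.mk k P P 1) :=
  LinearMap.ext fun p => diagonalCoaction_tmul_of_mem (one_mem _) p

theorem isColinear_flip_mk_one :
    IsColinear δ.toLinearMap (diagonalCoaction δ) ((TensorProduct.mk k P P).flip 1) := by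
  refine LinearMap.ext fun p => ?_
  simp only [diagonalCoaction, LinearMap.comp_apply, LinearMap.flip_apply, TensorProduct.mk_apply,
    TensorProduct.map_tmul, AlgHom.toLinearMap_apply, map_one, Algebra.TensorProduct.one_def]
  induction δ p using TensorProduct.induction_on with
  | zero => simp
  | add x y hx hy => simp only [TensorProduct.add_tmul, map_add, hx, hy]
  | tmul q h => simp

theorem isColinear_formsIncl :
    IsColinear (formsCoaction δ) (diagonalCoaction δ) (formsIncl k P) :=
  LinearMap.ext fun w => (formsIncl_formsCoaction δ w).symm

variable (k P) in
/-- The universal differential `d`, as a `k`-linear map. -/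
noncomputable def universalDLinear : P →ₗ[k] universalForms k P :=
  LinearMap.codRestrict ((universalForms k P).restrictScalars k)
    (TensorProduct.mk k P P 1 - (TensorProduct.mk k P P).flip 1) fun p => (universalD k P p).2

theorem isColinear_universalDLinear :
    IsColinear δ.toLinearMap (formsCoaction δ) (universalDLinear k P) :=
  isColinear_formsIncl.of_comp_injective Subtype.val_injective
    (isColinear_mk_one.sub isColinear_flip_mk_one)

/-- The map `p ↦ p ⊗ 1 + pr (d p)` attached to a left `P`-linear endomorphism `pr` of `Ω¹P`. If
`pr` is a strong connection, it takes values in `B ⊗ P` and splits the multiplication. -/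
noncomputable def connectionSplitting (pr : universalForms k P →ₗ[P] universalForms k P) :
    P →ₗ[k] P ⊗[k] P :=
  (TensorProduct.mk k P P).flip 1 +
    formsIncl k P ∘ₗ pr.restrictScalars k ∘ₗ universalDLinear k P

variable {pr : universalForms k P →ₗ[P] universalForms k P}

theorem connectionSplitting_apply (p : P) :
    connectionSplitting pr p = p ⊗ₜ[k] (1 : P) + (pr (universalD k P p) : P ⊗[k] P) :=
  rfl

theorem mul'_connectionSplitting (p : P) : LinearMap.mul' k P (connectionSplitting pr p) = p := by
  have h : LinearMap.mul' k P (pr (universalD k P p) : P ⊗[k] P) = 0 :=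
    (pr (universalD k P p)).2
  simp [connectionSplitting_apply, h]

namespace IsConnection

theorem apply_eq_zero (h : IsConnection δ pr) {w : universalForms k P}
    (hw : (w : P ⊗[k] P) ∈ horizontalForms (coinvariants δ)) : pr w = 0 := by
  rw [← h.ker_eq] at hw
  obtain ⟨w', hw', heq⟩ := hw
  rwa [← Subtype.ext heq]

theorem apply_universalD_mul (h : IsConnection δ pr) (b : coinvariants δ) (p : P) :
    pr (universalD k P (b * p)) = (b : P) • pr (universalD k P p) := by
  have hcoe : ((universalD k P (b * p) - (b : P) • universalD k P p : universalForms k P) :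
      P ⊗[k] P) = (1 : P) ⊗ₜ[k] (b * p) - (b : P) ⊗ₜ[k] p := by
    simp [universalD, smul_sub, TensorProduct.smul_tmul']
  rw [← map_smul, ← sub_eq_zero, ← map_sub]
  -- `d(b p) - b dp = (db) p` is horizontal.
  refine h.apply_eq_zero (Submodule.subset_span (Submodule.subset_span ?_))
  exact ⟨_, (universalD k (coinvariants δ) b).2, p, by rw [hcoe]; simp [universalD]⟩

theorem connectionSplitting_smul (h : IsConnection δ pr) (b : coinvariants δ) (p : P) :
    connectionSplitting pr (b • p) = b • connectionSplitting pr p := by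
  change connectionSplitting pr ((b : P) * p) = (b : P) • connectionSplitting pr p
  rw [connectionSplitting_apply, connectionSplitting_apply, h.apply_universalD_mul, smul_add,
    TensorProduct.smul_tmul', smul_eq_mul, Submodule.coe_smul]

theorem isColinear_connectionSplitting (h : IsConnection δ pr) :
    IsColinear δ.toLinearMap (diagonalCoaction δ) (connectionSplitting pr) :=
  isColinear_flip_mk_one.add
    (isColinear_formsIncl.comp (h.colinear.comp isColinear_universalDLinear))

end IsConnection

namespace IsStrongConnection

theorem connectionSplitting_mem_range (h : IsStrongConnection δ pr) (p : P) :
    connectionSplitting pr p ∈ LinearMap.range (tensorIncl (coinvariants δ)) := by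
  have hone : (1 : P) ⊗ₜ[k] p ∈ LinearMap.range (tensorIncl (coinvariants δ)) :=
    ⟨1 ⊗ₜ[k] p, by simp⟩
  have hsub : connectionSplitting pr p = (1 : P) ⊗ₜ[k] p -
      ((universalD k P p - pr (universalD k P p) : universalForms k P) : P ⊗[k] P) := by
    rw [connectionSplitting_apply]
    simp only [universalD, Submodule.coe_sub]
    abel
  rw [hsub]
  exact sub_mem hone (formsMul_le_range_tensorIncl (h.strong p))

theorem exists_isEquivariantSplitting (h : IsStrongConnection δ pr) :
    ∃ s, IsEquivariantSplitting δ s := by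
  let σ : P →ₗ[coinvariants δ] P ⊗[k] P :=
    { connectionSplitting pr with map_smul' := h.connectionSplitting_smul }
  let e := LinearEquiv.ofInjective _ (tensorIncl_injective (coinvariants δ))
  let s := e.symm.toLinearMap ∘ₗ σ.codRestrict _ h.connectionSplitting_mem_range
  have hs (p : P) : tensorIncl _ (s p) = connectionSplitting pr p :=
    congrArg Subtype.val (e.apply_symm_apply _)
  have hmul (x : coinvariants δ ⊗[k] P) :
      leftExtend (coinvariants δ) LinearMap.id x = LinearMap.mul' k P (tensorIncl _ x) := by
    induction x using TensorProduct.induction_on with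
    | zero => simp
    | add x y hx hy => simp only [map_add, hx, hy]
    | tmul b p => simp [Subalgebra.smul_def]
  refine ⟨s, fun p => by rw [hmul, hs, mul'_connectionSplitting], ?_⟩
  refine isColinear_tensorIncl.of_comp_injective (tensorIncl_injective _) ?_
  convert h.isColinear_connectionSplitting using 1
  exact LinearMap.ext hs

end IsStrongConnection

end StrongConnection

end Extension

end HopfGalois

open HopfGalois in
theorem corollary2p6_general {k H P V : Type*} [Field k] [Ring H] [HopfAlgebra k H]
    [Ring P] [Algebra k P] [AddCommGroup V] [Module k V] [FiniteDimensional k V]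
    {δ : P →ₐ[k] P ⊗[k] H} (hχ : Function.Bijective (canonicalMap δ))
    {s : P →ₗ[coinvariants δ] coinvariants δ ⊗[k] P} (hs : IsEquivariantSplitting δ s)
    (ρ : V →ₗ[k] V ⊗[k] H) :
    Module.Finite (coinvariants δ) (colinearHom ρ δ) ∧
      Module.Projective (coinvariants δ) (colinearHom ρ δ) := by
  obtain ⟨W, hW, hsW⟩ := exists_finiteDimensional_forall_colinear_slice_mem hχ s ρ
  let K : Submodule k (V →ₗ[k] P) :=
    LinearMap.range (LinearMap.compRight k W.subtype) ⊓ (colinearHom ρ δ).restrictScalars k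
  have : FiniteDimensional k K := Submodule.finiteDimensional_inf_left _ _
  refine finite_projective_of_slice_mem (K := K) inf_le_right
    (splitHom s ∘ₗ (colinearHom ρ δ).subtype) (fun φ => ?_) fun φ f => ?_
  · ext v
    simp [← leftExtend_tensorHomEquiv, tensorHomEquiv_splitHom, hs.leftExtend_apply]
  · have hslice : slice f (splitHom s φ.1) = slice f ∘ₗ s.restrictScalars k ∘ₗ φ.1 := by
      rw [← slice_tensorHomEquiv, tensorHomEquiv_splitHom]
    rw [LinearMap.comp_apply, Submodule.subtype_apply, hslice]
    exact ⟨⟨LinearMap.codRestrict W (slice f ∘ₗ s.restrictScalars k ∘ₗ φ.1) (hsW φ.1 φ.2 f), rfl⟩,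
      (isColinear_slice _ f).comp (hs.colinear.comp φ.2)⟩

theorem corollary2p6 {k H P V : Type*} [Field k] [Ring H] [HopfAlgebra k H]
    [Ring P] [Algebra k P] [AddCommGroup V] [Module k V] [FiniteDimensional k V]
    (hS : Function.Bijective (HopfAlgebra.antipode k : H →ₗ[k] H))
    (δ : P →ₐ[k] P ⊗[k] H) (hδ : HopfGalois.IsHopfGaloisExtension δ)
    (hstrong : ∃ pr : HopfGalois.universalForms k P →ₗ[P] HopfGalois.universalForms k P,
      HopfGalois.IsStrongConnection δ pr)
    (ρ : V →ₗ[k] V ⊗[k] H) (hρ : HopfGalois.IsCorepresentation ρ) :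
    Module.Finite (HopfGalois.coinvariants δ) (HopfGalois.colinearHom ρ δ) ∧
      Module.Projective (HopfGalois.coinvariants δ) (HopfGalois.colinearHom ρ δ) := by
  obtain ⟨pr, hpr⟩ := hstrong
  obtain ⟨s, hs⟩ := hpr.exists_isEquivariantSplitting
  exact corollary2p6_general hδ.bijective_canonicalMap hs ρ
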